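/- Let $E$ be a nonempty finite set and $X=E^{\mathbb Z}$ with the product topology and its Borel $\sigma$-algebra. Let $\Phi=\{\Phi_\Lambda\}_{\Lambda\Subset\mathbb Z}$ be an interaction, i.e. a family of functions $\Phi_\Lambda:X\to\mathbb R$, indexed by the finite subsets $\Lambda$ of $\mathbb Z$, such that $\Phi_\Lambda(\sigma)$ depends only on the restriction $\sigma_\Lambda$ of $\sigma$ to $\Lambda$. Assume that $\Phi$ is uniformly absolutely convergent, $\sup_{i\in\mathbb Z}\sum_{V\ni i}\|\Phi_V\|_\infty<\infty$, and satisfies the Dobrushin uniqueness condition $$\frac12\,\sup_{i\in\mathbb Z}\ \sum_{\Lambda\ni i}(|\Lambda|-1)\,\delta(\Phi_\Lambda)<1,\qquad \delta(f):=\sup_{\xi,\eta\in X}|f(\xi)-f(\eta)|.$$ For a uniformly absolutely convergent interaction $\Psi$ and finite $\Lambda$ put $H^\Psi_\Lambda=\sum_{V\cap\Lambda\ne\emptyset}\Psi_V$ and, for $\xi\in E^\Lambda$ and $\eta\in X$, $$\gamma^\Psi_\Lambda(\xi\,|\,\eta)=\frac{e^{-H^\Psi_\Lambda(\xi\eta_{\Lambda^c})}}{\sum_{\bar\xi\in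 E^\Lambda}e^{-H^\Psi_\Lambda(\bar\xi\eta_{\Lambda^c})}},\qquad \gamma^\Psi_\Lambda f(\sigma)=\sum_{\xi\in E^\Lambda}\gamma^\Psi_\Lambda(\xi\,|\,\sigma)\,f(\xi\sigma_{\Lambda^c}),$$ where $\xi\eta_{\Lambda^c}$ is the configuration equal to $\xi$ on $\Lambda$ and to $\eta$ off $\Lambda$. A Borel probability measure $\mu$ on $X$ is a Gibbs measure for $\Psi$ if $\int\gamma^\Psi_\Lambda f\,d\mu=\int f\,d\mu$ for every finite $\Lambda\subset\mathbb Z$ and every $f\in L^1(\mu)$. Let $\Lambda_1,\Lambda_2,\dots$ be an arbitrary enumeration, without repetition, of all finite $\Lambda\subset\mathbb Z$ with $\min\Lambda<0\le\max\Lambda$. For $k\ge0$ let $\Psi^{(k)}$ be the interaction with $\Psi^{(k)}_\Lambda=0$ if $\Lambda\in\{\Lambda_i:i\ge k+1\}$ and $\Psi^{(k)}_\Lambda=\Phi_\Lambda$ otherwise. Then every $\Psi^{(k)}$, $k\ge0$, has exactly one Gibbs measure $\nu^{(k)}$, and $\nu^{(k)}$ is absolutely continuous with respect to $\nu^{(0)}$.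 If, moreover, the family of densities $f^{(k)}=d\nu^{(k)}/d\nu^{(0)}$, $k\ge0$, is uniformly integrable in $L^1(\nu^{(0)})$, then every weak$^*$ limit point of the sequence $(\nu^{(k)})_{k\ge0}$ is a Gibbs measure for $\Phi$ and is absolutely continuous with respect to $\nu^{(0)}$. -/

import Mathlib

open MeasureTheory Filter Topology
open scoped ENNReal

namespace LatticeGibbs

/-- An interaction on the lattice `ℤ` with spin space `E`: a family of real functions on `E^ℤ`
indexed by the finite subsets of `ℤ`, the one indexed by `Λ` depending only on the spins in `Λ`. -/
structure Interaction (E : Type*) where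
  /-- The potential of the finite set `Λ`. -/
  pot : Finset ℤ → (ℤ → E) → ℝ
  /-- It depends only on the spins in `Λ`. -/
  isLocal : ∀ (Λ : Finset ℤ) (σ τ : ℤ → E), (∀ i ∈ Λ, σ i = τ i) → pot Λ σ = pot Λ τ

/-- The supremum norm of `f`, as an extended nonnegative real. -/
noncomputable def supNorm {E : Type*} (f : (ℤ → E) → ℝ) : ℝ≥0∞ := ⨆ σ, ‖f σ‖ₑ

/-- The variation (oscillation) `sup |f ξ - f η|` of `f`, as an extended nonnegative real. -/
noncomputable def oscillation {E : Type*} (f : (ℤ → E) → ℝ) : ℝ≥0∞ := ⨆ ξ, ⨆ η, ‖f ξ - f η‖ₑ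

/-- Concatenation: the configuration equal to `ξ` on `Λ` and to `η` off `Λ`. -/
def concat {E : Type*} (Λ : Finset ℤ) (ξ : Λ → E) (η : ℤ → E) : ℤ → E :=
  fun i => if h : i ∈ Λ then ξ ⟨i, h⟩ else η i

namespace Interaction

variable {E : Type*}

/-- Uniform absolute convergence: `sup_i ∑_{V ∋ i} ‖Φ_V‖_∞ < ∞`. -/
def UniformlyAbsolutelyConvergent (Φ : Interaction E) : Prop :=
  ⨆ i : ℤ, ∑' V : {V : Finset ℤ // i ∈ V}, supNorm (Φ.pot V) < ⊤

/-- The constant `(1/2) sup_i ∑_{Λ ∋ i} (|Λ| - 1) δ(Φ_Λ)`. -/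
noncomputable def dobrushinConstant (Φ : Interaction E) : ℝ≥0∞ :=
  2⁻¹ * ⨆ i : ℤ, ∑' Λ : {Λ : Finset ℤ // i ∈ Λ},
    ((Λ.1.card - 1 : ℕ) : ℝ≥0∞) * oscillation (Φ.pot Λ)

/-- The Hamiltonian in the volume `Λ`: the sum of `Φ_V` over all finite `V` that meet `Λ`. -/
noncomputable def hamiltonian (Φ : Interaction E) (Λ : Finset ℤ) (σ : ℤ → E) : ℝ :=
  ∑' V : {V : Finset ℤ // (V ∩ Λ).Nonempty}, Φ.pot V σ

/-- The partition function in the volume `Λ` with boundary condition `η`. -/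
noncomputable def partitionFunction [Fintype E] (Φ : Interaction E) (Λ : Finset ℤ)
    (η : ℤ → E) : ℝ :=
  ∑ ξ : Λ → E, Real.exp (-Φ.hamiltonian Λ (concat Λ ξ η))

/-- The specification density `γ_Λ(ξ | η)`. -/
noncomputable def specDensity [Fintype E] (Φ : Interaction E) (Λ : Finset ℤ)
    (ξ : Λ → E) (η : ℤ → E) : ℝ :=
  Real.exp (-Φ.hamiltonian Λ (concat Λ ξ η)) / Φ.partitionFunction Λ η

/-- The action of the specification kernel in the volume `Λ` on a function `f`. -/
noncomputable def specAvg [Fintype E] (Φ : Interaction E) (Λ : Finset ℤ)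
    (f : (ℤ → E) → ℝ) (σ : ℤ → E) : ℝ :=
  ∑ ξ : Λ → E, Φ.specDensity Λ ξ σ * f (concat Λ ξ σ)

/-- `μ` is a Gibbs measure for `Φ`: the DLR equations hold for all finite volumes and all
`μ`-integrable functions. -/
def IsGibbs [Fintype E] [MeasurableSpace E] (Φ : Interaction E)
    (μ : ProbabilityMeasure (ℤ → E)) : Prop :=
  ∀ (Λ : Finset ℤ) (f : (ℤ → E) → ℝ), Integrable f (μ : Measure (ℤ → E)) →
    ∫ σ, Φ.specAvg Λ f σ ∂(μ : Measure (ℤ → E)) = ∫ σ, f σ ∂(μ : Measure (ℤ → E))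

end Interaction

/-- The finite subsets of `ℤ` that link the negative half-line with the nonnegative half-line. -/
def crossingSets : Set (Finset ℤ) := {Λ | Λ.min < 0 ∧ 0 ≤ Λ.max}

open scoped Classical in
/-- The intermediate interaction `Ψ^(k)` for the enumeration `Λ_1 = e 0, Λ_2 = e 1, …` of the
crossing sets: the potentials of all `Λ_i` with `i ≥ k + 1`, i.e. of all `e j` with `j ≥ k`,
are replaced by zero. -/
noncomputable def Interaction.intermediate {E : Type*} (Φ : Interaction E) (e : ℕ ≃ crossingSets)
    (k : ℕ) : Interaction E where
  pot Λ σ := if ∃ j, k ≤ j ∧ (e j : Finset ℤ) = Λ then 0 else Φ.pot Λ σ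
  isLocal Λ σ τ h := by rw [Φ.isLocal Λ σ τ h]

end LatticeGibbs

/-!
Energies enter the specification only through differences, and for configurations that agree off
`Λ` the energy difference is the same in every volume containing `Λ`
(`hamiltonian_sub_hamiltonian`). This gives the consistency of the specification
(`specAvg_specAvg`), so that limit points of finite-volume Gibbs measures, which exist because the
space of probability measures on a compact metrizable space is compact, are Gibbs measures
(`exists_isGibbs`).

Uniqueness is Dobrushin's theorem (`IsGibbs.eq`). Averaging over the spin at `i` removes the
oscillation of a function at `i` and transports it to the sites `j` with weights `C i j`
(`siteOscillation_specAvg_le`), where `∑ j, C i j` is at most the Dobrushin constant. The sharp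
factor `1/2` comes from the fact that a perturbation of the energy of size `c` changes the
probability of any event by at most `c/2` (`div_add_sub_div_add_le`). Hence, if the integrals of
every continuous function `f` against two Gibbs measures differ by at most
`c * ∑ j, siteOscillation j f`, then the same holds with `α * c` for some fixed `α < 1`, and the two
measures agree.

The interactions `Ψ^(k)` inherit both hypotheses on `Φ`. Since `Ψ^(k)` differs from `Ψ^(0)` by
finitely many potentials, of sum `W`, the normalized density `exp (-W)` turns the Gibbs measure for
`Ψ^(0)` into one for `Ψ^(k)` (`IsGibbs.tilted`), which by uniqueness is `ν^(k)`; so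
`ν^(k) ≪ ν^(0)`. Finally, the Hamiltonians of `Ψ^(k)` converge uniformly to those of `Φ`, so that the
DLR equations pass to weak limits (`isGibbs_of_tendsto`), and uniform integrability makes absolute
continuity pass to weak limits (`absolutelyContinuous_of_tendsto`).
-/

namespace LatticeGibbs

/-! ### Boltzmann averages on a finite set -/

section Boltzmann

variable {ι : Type*} [Fintype ι]

/-- The average of `g` with respect to the probability weights proportional to `exp (-h)` on a
finite type. -/
noncomputable def boltzmannAvg (h g : ι → ℝ) : ℝ :=
  (∑ x, Real.exp (-h x) * g x) / ∑ x, Real.exp (-h x)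

lemma sum_exp_neg_pos [Nonempty ι] (h : ι → ℝ) : 0 < ∑ x, Real.exp (-h x) :=
  Finset.sum_pos (fun _ _ => Real.exp_pos _) Finset.univ_nonempty

lemma boltzmannAvg_const [Nonempty ι] (h : ι → ℝ) (c : ℝ) : boltzmannAvg h (fun _ => c) = c := by
  rw [boltzmannAvg, ← Finset.sum_mul, mul_div_assoc, mul_div_cancel₀]
  exact (sum_exp_neg_pos h).ne'

lemma boltzmannAvg_sub (h g g' : ι → ℝ) :
    boltzmannAvg h (fun x => g x - g' x) = boltzmannAvg h g - boltzmannAvg h g' := by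
  simp only [boltzmannAvg, ← sub_div, mul_sub, Finset.sum_sub_distrib]

/-- Boltzmann averages do not change when a constant is added to the energy. -/
lemma boltzmannAvg_congr_add_const {h h' : ι → ℝ} (g : ι → ℝ) (hh : ∀ x y, h x - h y = h' x - h' y) :
    boltzmannAvg h g = boltzmannAvg h' g := by
  rcases isEmpty_or_nonempty ι with hι | ⟨⟨y⟩⟩
  · simp [boltzmannAvg]
  have key : ∀ x, Real.exp (-h x) = Real.exp (h' y - h y) * Real.exp (-h' x) := fun x => by
    rw [← Real.exp_add]
    congr 1
    linarith [hh x y]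
  simp only [boltzmannAvg, key, mul_assoc, ← Finset.mul_sum]
  rw [mul_div_mul_left _ _ (Real.exp_pos _).ne']

/-- Averaging against the tilted weight `exp (-w)` amounts to adding `w` to the energy. -/
lemma boltzmannAvg_mul_exp [Nonempty ι] (h w g : ι → ℝ) :
    boltzmannAvg h (fun x => g x * Real.exp (-w x)) =
      boltzmannAvg (fun x => h x + w x) g * boltzmannAvg h (fun x => Real.exp (-w x)) := by
  have e : ∀ x, Real.exp (-(h x + w x)) = Real.exp (-h x) * Real.exp (-w x) := fun x => by
    rw [← Real.exp_add]; congr 1; ring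
  have hp := sum_exp_neg_pos (fun x => h x + w x)
  simp only [boltzmannAvg, e] at hp ⊢
  rw [div_mul_div_cancel₀ hp.ne']
  congr 1
  exact Finset.sum_congr rfl fun x _ => by ring

lemma abs_boltzmannAvg_le [Nonempty ι] (h : ι → ℝ) {g : ι → ℝ} {M : ℝ} (hM : ∀ x, |g x| ≤ M) :
    |boltzmannAvg h g| ≤ M := by
  have hp := sum_exp_neg_pos h
  rw [boltzmannAvg, abs_div, abs_of_pos hp, div_le_iff₀ hp, Finset.mul_sum]
  refine (Finset.abs_sum_le_sum_abs _ _).trans (Finset.sum_le_sum fun x _ => ?_)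
  rw [abs_mul, abs_of_pos (Real.exp_pos _), mul_comm]
  exact mul_le_mul_of_nonneg_right (hM x) (Real.exp_pos _).le

lemma enorm_boltzmannAvg_le [Nonempty ι] (h : ι → ℝ) {g : ι → ℝ} {M : ℝ≥0∞}
    (hM : ∀ x, ‖g x‖ₑ ≤ M) : ‖boltzmannAvg h g‖ₑ ≤ M := by
  obtain ⟨x₀, hx₀⟩ := Finite.exists_max fun x => |g x|
  refine le_trans ?_ (hM x₀)
  rw [enorm_le_iff_norm_le]
  exact abs_boltzmannAvg_le h hx₀

lemma sigmoid_sub_le {x y c : ℝ} (hc : 0 ≤ c) (h : x - y ≤ c) :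
    Real.sigmoid x - Real.sigmoid y ≤ c / 4 := by
  rcases le_total x y with hxy | hxy
  · linarith [Real.sigmoid_monotone hxy]
  have key := Convex.norm_image_sub_le_of_norm_deriv_le (f := Real.sigmoid) (C := 1 / 4)
    (s := Set.univ) (fun z _ => differentiable_sigmoid z) (fun z _ => by
      rw [Real.deriv_sigmoid, Real.norm_eq_abs, abs_of_nonneg
        (mul_nonneg (Real.sigmoid_nonneg z) (by linarith [Real.sigmoid_le_one z]))]
      nlinarith [sq_nonneg (Real.sigmoid z - 1 / 2)]) convex_univ (Set.mem_univ y) (Set.mem_univ x)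
  rw [Real.norm_eq_abs, Real.norm_eq_abs, abs_of_nonneg (sub_nonneg.2 hxy)] at key
  linarith [le_abs_self (Real.sigmoid x - Real.sigmoid y)]

/-- A probability whose odds are changed by a factor at most `exp (2c)` changes by at most `c/2`,
because the logistic function is `1/4`-Lipschitz. -/
lemma div_add_sub_div_add_le {a b a' b' c : ℝ} (ha : 0 ≤ a) (hb : 0 ≤ b) (ha' : 0 ≤ a')
    (hb' : 0 ≤ b') (hc : 0 ≤ c) (h₁ : a ≤ Real.exp c * a') (h₂ : b' ≤ Real.exp c * b) :
    a / (a + b) - a' / (a' + b') ≤ c / 2 := by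
  rcases ha.eq_or_lt with rfl | ha
  · have : 0 ≤ a' / (a' + b') := by positivity
    simp only [zero_div]
    linarith
  have ha' : 0 < a' := by
    by_contra h
    have : a' = 0 := by linarith
    subst this
    linarith
  rcases hb'.eq_or_lt with rfl | hb'
  · have : a / (a + b) ≤ 1 := div_le_one_of_le₀ (by linarith) (by linarith)
    rw [add_zero, div_self ha'.ne']
    linarith
  have hb : 0 < b := by
    by_contra h
    have : b = 0 := by linarith
    subst this
    linarith
  have hs : ∀ {s t : ℝ}, 0 < s → 0 < t → s / (s + t) = Real.sigmoid (Real.log s - Real.log t) := by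
    intro s t hs ht
    rw [Real.sigmoid_def, neg_sub, Real.exp_sub, Real.exp_log hs, Real.exp_log ht]
    field_simp
  rw [hs ha hb, hs ha' hb']
  have l₁ := Real.log_le_log ha h₁
  have l₂ := Real.log_le_log hb' h₂
  rw [Real.log_mul (Real.exp_pos _).ne' ha'.ne', Real.log_exp] at l₁
  rw [Real.log_mul (Real.exp_pos _).ne' hb.ne', Real.log_exp] at l₂
  have := sigmoid_sub_le (x := Real.log a - Real.log b) (y := Real.log a' - Real.log b')
    (c := 2 * c) (by linarith) (by linarith)
  linarith

lemma boltzmannAvg_sub_le [Nonempty ι] {h h' g : ι → ℝ} {c M : ℝ} (hc : ∀ x, |h x - h' x| ≤ c)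
    (hM : ∀ x y, g x - g y ≤ M) : boltzmannAvg h g - boltzmannAvg h' g ≤ c / 2 * M := by
  classical
  obtain ⟨x₀, hx₀⟩ := Finite.exists_min g
  have hc₀ : 0 ≤ c := (abs_nonneg _).trans (hc x₀)
  have hM₀ : 0 ≤ M := by simpa using hM x₀ x₀
  have hZ := sum_exp_neg_pos h
  have hZ' := sum_exp_neg_pos h'
  set w : ι → ℝ := fun x => Real.exp (-h x) / ∑ y, Real.exp (-h y) with hw
  set w' : ι → ℝ := fun x => Real.exp (-h' x) / ∑ y, Real.exp (-h' y) with hw'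
  have e : ∀ k : ι → ℝ, ∀ u : ι → ℝ, boltzmannAvg k u =
      ∑ x, Real.exp (-k x) / (∑ y, Real.exp (-k y)) * u x := fun k u => by
    simp only [boltzmannAvg, div_mul_eq_mul_div, Finset.sum_div]
  -- subtracting the minimum of `g` makes the test function nonnegative
  have e₁ : boltzmannAvg h g - boltzmannAvg h' g = ∑ x, (w x - w' x) * (g x - g x₀) := by
    have t₁ := boltzmannAvg_sub h g (fun _ => g x₀)
    have t₂ := boltzmannAvg_sub h' g (fun _ => g x₀)
    rw [boltzmannAvg_const] at t₁ t₂
    have : boltzmannAvg h g - boltzmannAvg h' g = boltzmannAvg h (fun x => g x - g x₀)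
        - boltzmannAvg h' (fun x => g x - g x₀) := by linarith
    rw [this, e, e, ← Finset.sum_sub_distrib]
    exact Finset.sum_congr rfl fun x _ => by ring
  set A := Finset.univ.filter fun x => w' x ≤ w x
  have hA : ∑ x ∈ A, (w x - w' x) ≤ c / 2 := by
    have hs : ∀ k : ι → ℝ, ∑ x ∈ A, Real.exp (-k x) / (∑ y, Real.exp (-k y)) =
        (∑ x ∈ A, Real.exp (-k x)) / (∑ x ∈ A, Real.exp (-k x) + ∑ x ∈ Aᶜ, Real.exp (-k x)) :=
      fun k => by rw [Finset.sum_add_sum_compl, Finset.sum_div]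
    rw [Finset.sum_sub_distrib, hs h, hs h']
    have le : ∀ x, Real.exp (-h x) ≤ Real.exp c * Real.exp (-h' x) := fun x => by
      rw [← Real.exp_add, Real.exp_le_exp]; linarith [(abs_le.1 (hc x)).1]
    have le' : ∀ x, Real.exp (-h' x) ≤ Real.exp c * Real.exp (-h x) := fun x => by
      rw [← Real.exp_add, Real.exp_le_exp]; linarith [(abs_le.1 (hc x)).2]
    refine div_add_sub_div_add_le ?_ ?_ ?_ ?_ hc₀ ?_ ?_
    any_goals exact Finset.sum_nonneg fun x _ => (Real.exp_pos _).le
    · rw [Finset.mul_sum]; exact Finset.sum_le_sum fun x _ => le x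
    · rw [Finset.mul_sum]; exact Finset.sum_le_sum fun x _ => le' x
  calc boltzmannAvg h g - boltzmannAvg h' g
      = ∑ x, (w x - w' x) * (g x - g x₀) := e₁
    _ ≤ ∑ x ∈ A, (w x - w' x) * (g x - g x₀) := by
        rw [Finset.sum_filter]
        refine Finset.sum_le_sum fun x _ => ?_
        split_ifs with hx
        · exact le_rfl
        · exact mul_nonpos_of_nonpos_of_nonneg (by linarith) (sub_nonneg.2 (hx₀ x))
    _ ≤ ∑ x ∈ A, (w x - w' x) * M := by
        refine Finset.sum_le_sum fun x hx => mul_le_mul_of_nonneg_left (hM x x₀) ?_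
        exact sub_nonneg.2 (Finset.mem_filter.1 hx).2
    _ ≤ c / 2 * M := by
        rw [← Finset.sum_mul]
        exact mul_le_mul_of_nonneg_right hA hM₀

lemma abs_boltzmannAvg_sub_le [Nonempty ι] {h h' g : ι → ℝ} {c M : ℝ} (hc : ∀ x, |h x - h' x| ≤ c)
    (hM : ∀ x y, g x - g y ≤ M) : |boltzmannAvg h g - boltzmannAvg h' g| ≤ c / 2 * M :=
  abs_sub_le_iff.2 ⟨boltzmannAvg_sub_le hc hM,
    boltzmannAvg_sub_le (fun x => abs_sub_comm (h x) (h' x) ▸ hc x) hM⟩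

/-- Changing the energy by at most `c` in supremum norm changes the average of `g` by at most
`c/2` times the oscillation of `g`. The constant `1/2` is the one in Dobrushin's condition. -/
lemma enorm_boltzmannAvg_sub_le [Nonempty ι] {h h' g : ι → ℝ} {c M : ℝ≥0∞}
    (hc : ∀ x, ‖h x - h' x‖ₑ ≤ c) (hM : ∀ x y, ‖g x - g y‖ₑ ≤ M) :
    ‖boltzmannAvg h g - boltzmannAvg h' g‖ₑ ≤ 2⁻¹ * c * M := by
  obtain ⟨x₀, hx₀⟩ := Finite.exists_max fun x => |h x - h' x|
  obtain ⟨⟨y₁, y₂⟩, hy⟩ := Finite.exists_max fun p : ι × ι => |g p.1 - g p.2|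
  have hM' : ∀ x y, g x - g y ≤ |g y₁ - g y₂| := fun x y => (le_abs_self _).trans (hy (x, y))
  have key : |boltzmannAvg h g - boltzmannAvg h' g| ≤ |h x₀ - h' x₀| / 2 * |g y₁ - g y₂| :=
    abs_boltzmannAvg_sub_le hx₀ hM'
  calc ‖boltzmannAvg h g - boltzmannAvg h' g‖ₑ
      ≤ ENNReal.ofReal (|h x₀ - h' x₀| / 2 * |g y₁ - g y₂|) := by
        rw [← ofReal_norm]
        exact ENNReal.ofReal_le_ofReal key
    _ = 2⁻¹ * ‖h x₀ - h' x₀‖ₑ * ‖g y₁ - g y₂‖ₑ := by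
        rw [ENNReal.ofReal_mul (by positivity), ENNReal.ofReal_div_of_pos two_pos,
          ← ofReal_norm, ← ofReal_norm, Real.norm_eq_abs, Real.norm_eq_abs,
          ENNReal.ofReal_ofNat, ENNReal.div_eq_inv_mul]
    _ ≤ 2⁻¹ * c * M := by gcongr <;> [exact hc x₀; exact hM _ _]

end Boltzmann

/-! ### Hamiltonians -/

section Concat

variable {E : Type*}

lemma concat_of_mem {Λ : Finset ℤ} {i : ℤ} (hi : i ∈ Λ) (ξ : Λ → E) (η : ℤ → E) :
    concat Λ ξ η i = ξ ⟨i, hi⟩ := by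
  simp [concat, hi]

lemma concat_of_notMem {Λ : Finset ℤ} {i : ℤ} (hi : i ∉ Λ) (ξ : Λ → E) (η : ℤ → E) :
    concat Λ ξ η i = η i := by
  simp [concat, hi]

lemma concat_congr {Λ : Finset ℤ} (ξ : Λ → E) {σ τ : ℤ → E} (h : ∀ i ∉ Λ, σ i = τ i) :
    concat Λ ξ σ = concat Λ ξ τ := by
  ext i
  by_cases hi : i ∈ Λ
  · rw [concat_of_mem hi, concat_of_mem hi]
  · rw [concat_of_notMem hi, concat_of_notMem hi, h i hi]

lemma continuous_concat [TopologicalSpace E] (Λ : Finset ℤ) (ξ : Λ → E) :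
    Continuous (concat Λ ξ) := by
  refine continuous_pi fun i => ?_
  by_cases hi : i ∈ Λ
  · simp only [concat_of_mem hi, continuous_const]
  · simp only [concat_of_notMem hi, continuous_apply i]

end Concat

lemma enorm_le_supNorm {E : Type*} (f : (ℤ → E) → ℝ) (σ : ℤ → E) : ‖f σ‖ₑ ≤ supNorm f :=
  le_iSup (fun σ => ‖f σ‖ₑ) σ

lemma enorm_sub_le_oscillation {E : Type*} (f : (ℤ → E) → ℝ) (σ τ : ℤ → E) :
    ‖f σ - f τ‖ₑ ≤ oscillation f :=
  (le_iSup (fun τ => ‖f σ - f τ‖ₑ) τ).trans (le_iSup (fun σ => ⨆ τ, ‖f σ - f τ‖ₑ) σ)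

namespace Interaction

variable {E : Type*}

lemma continuous_pot [Finite E] [TopologicalSpace E] [DiscreteTopology E] (Φ : Interaction E)
    (V : Finset ℤ) : Continuous (Φ.pot V) := by
  rcases isEmpty_or_nonempty (ℤ → E) with h | ⟨⟨η⟩⟩
  · exact continuous_of_const fun x => (h.false x).elim
  have : Φ.pot V = (fun ξ : V → E => Φ.pot V (concat V ξ η)) ∘ fun σ i => σ i := by
    ext σ
    exact Φ.isLocal V _ _ fun i hi => (concat_of_mem hi (fun j : V => σ j) η).symm
  rw [this]
  exact continuous_of_discreteTopology.comp (by fun_prop)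

lemma tsum_supNorm_inter_lt_top {Φ : Interaction E} (h : Φ.UniformlyAbsolutelyConvergent)
    (Λ : Finset ℤ) :
    ∑' V : {V : Finset ℤ // (V ∩ Λ).Nonempty}, supNorm (Φ.pot V) < ⊤ := by
  have hi : ∀ i : ℤ, ∑' V : {V : Finset ℤ // i ∈ V}, supNorm (Φ.pot V) < ⊤ := fun i =>
    (le_iSup (fun i : ℤ => ∑' V : {V : Finset ℤ // i ∈ V}, supNorm (Φ.pot V)) i).trans_lt h
  calc ∑' V : {V : Finset ℤ // (V ∩ Λ).Nonempty}, supNorm (Φ.pot V)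
      = ∑' V : Finset ℤ, {V : Finset ℤ | (V ∩ Λ).Nonempty}.indicator
          (fun V => supNorm (Φ.pot V)) V :=
        tsum_subtype {V : Finset ℤ | (V ∩ Λ).Nonempty} fun V => supNorm (Φ.pot V)
    _ ≤ ∑' V : Finset ℤ, ∑ i ∈ Λ, {V : Finset ℤ | i ∈ V}.indicator
          (fun V => supNorm (Φ.pot V)) V := by
        refine ENNReal.tsum_le_tsum fun V => ?_
        by_cases hV : (V ∩ Λ).Nonempty
        · obtain ⟨i, hi⟩ := hV
          obtain ⟨hiV, hiΛ⟩ := Finset.mem_inter.1 hi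
          rw [Set.indicator_of_mem (show V ∈ {V : Finset ℤ | (V ∩ Λ).Nonempty} from ⟨i, hi⟩)]
          refine le_trans ?_ (Finset.single_le_sum (fun _ _ => zero_le) hiΛ)
          rw [Set.indicator_of_mem (show V ∈ {V : Finset ℤ | i ∈ V} from hiV)]
        · rw [Set.indicator_of_notMem (show V ∉ {V : Finset ℤ | (V ∩ Λ).Nonempty} from hV)]
          exact zero_le
    _ = ∑ i ∈ Λ, ∑' V : {V : Finset ℤ // i ∈ V}, supNorm (Φ.pot V) := by
        rw [Summable.tsum_finsetSum fun _ _ => ENNReal.summable]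
        exact Finset.sum_congr rfl fun i _ =>
          (tsum_subtype {V : Finset ℤ | i ∈ V} fun V => supNorm (Φ.pot V)).symm
    _ < ⊤ := ENNReal.sum_lt_top.2 fun i _ => hi i

lemma summable_toReal_supNorm {Φ : Interaction E} (h : Φ.UniformlyAbsolutelyConvergent)
    (Λ : Finset ℤ) :
    Summable fun V : {V : Finset ℤ // (V ∩ Λ).Nonempty} => (supNorm (Φ.pot V)).toReal :=
  ENNReal.summable_toReal (tsum_supNorm_inter_lt_top h Λ).ne

lemma norm_pot_le {Φ : Interaction E} (h : Φ.UniformlyAbsolutelyConvergent) {Λ : Finset ℤ}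
    (V : {V : Finset ℤ // (V ∩ Λ).Nonempty}) (σ : ℤ → E) :
    ‖Φ.pot V σ‖ ≤ (supNorm (Φ.pot V)).toReal := by
  rw [← toReal_enorm]
  exact ENNReal.toReal_mono (ENNReal.ne_top_of_tsum_ne_top (tsum_supNorm_inter_lt_top h Λ).ne V)
    (enorm_le_supNorm _ σ)

lemma summable_pot {Φ : Interaction E} (h : Φ.UniformlyAbsolutelyConvergent) (Λ : Finset ℤ)
    (σ : ℤ → E) : Summable fun V : {V : Finset ℤ // (V ∩ Λ).Nonempty} => Φ.pot V σ :=
  Summable.of_norm_bounded (summable_toReal_supNorm h Λ) fun V => norm_pot_le h V σ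

lemma continuous_hamiltonian [Finite E] [TopologicalSpace E] [DiscreteTopology E]
    {Φ : Interaction E} (h : Φ.UniformlyAbsolutelyConvergent) (Λ : Finset ℤ) :
    Continuous (Φ.hamiltonian Λ) :=
  continuous_tsum (fun V => Φ.continuous_pot V) (summable_toReal_supNorm h Λ)
    fun V σ => norm_pot_le h V σ

/-- A potential in a set that does not meet `Λ` ignores the spins in `Λ`. -/
lemma pot_congr (Φ : Interaction E) {Λ V : Finset ℤ} (hV : ¬ (V ∩ Λ).Nonempty) {σ τ : ℤ → E}
    (hστ : ∀ i ∉ Λ, σ i = τ i) : Φ.pot V σ = Φ.pot V τ := by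
  refine Φ.isLocal V σ τ fun i hi => hστ i fun hi' => hV ⟨i, Finset.mem_inter.2 ⟨hi, hi'⟩⟩

lemma support_pot_sub_subset (Φ : Interaction E) {Λ Δ : Finset ℤ} (hΛ : Λ ⊆ Δ) {σ τ : ℤ → E}
    (hστ : ∀ i ∉ Λ, σ i = τ i) :
    (Function.support fun V : Finset ℤ => Φ.pot V σ - Φ.pot V τ) ⊆
      {V : Finset ℤ | (V ∩ Δ).Nonempty} := by
  intro V hV
  by_contra h
  refine hV (sub_eq_zero.2 (Φ.pot_congr (fun h' => h ?_) hστ))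
  exact h'.mono (Finset.inter_subset_inter_left hΛ)

lemma summable_pot_sub {Φ : Interaction E} (h : Φ.UniformlyAbsolutelyConvergent) {Λ : Finset ℤ}
    {σ τ : ℤ → E} (hστ : ∀ i ∉ Λ, σ i = τ i) :
    Summable fun V : Finset ℤ => Φ.pot V σ - Φ.pot V τ := by
  rw [← Set.indicator_eq_self.2 (Φ.support_pot_sub_subset (subset_refl Λ) hστ)]
  exact (summable_subtype_iff_indicator (s := {V : Finset ℤ | (V ∩ Λ).Nonempty})
    (f := fun V => Φ.pot V σ - Φ.pot V τ)).1 ((summable_pot h Λ σ).sub (summable_pot h Λ τ))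

/-- For configurations that agree off `Λ`, the energy difference is the same in all volumes
containing `Λ`: it is the sum of the differences of all potentials. -/
lemma hamiltonian_sub_hamiltonian {Φ : Interaction E} (h : Φ.UniformlyAbsolutelyConvergent)
    {Λ Δ : Finset ℤ} (hΛ : Λ ⊆ Δ) {σ τ : ℤ → E} (hστ : ∀ i ∉ Λ, σ i = τ i) :
    Φ.hamiltonian Δ σ - Φ.hamiltonian Δ τ = ∑' V : Finset ℤ, (Φ.pot V σ - Φ.pot V τ) := by
  rw [hamiltonian, hamiltonian, ← (summable_pot h Δ σ).tsum_sub (summable_pot h Δ τ)]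
  exact tsum_subtype_eq_of_support_subset (s := {V : Finset ℤ | (V ∩ Δ).Nonempty})
    (f := fun V : Finset ℤ => Φ.pot V σ - Φ.pot V τ) (Φ.support_pot_sub_subset hΛ hστ)

/-! ### Specifications -/

section Specification

variable [Fintype E]

lemma specAvg_eq_boltzmannAvg (Φ : Interaction E) (Λ : Finset ℤ) (f : (ℤ → E) → ℝ) (σ : ℤ → E) :
    Φ.specAvg Λ f σ = boltzmannAvg (fun ξ : Λ → E => Φ.hamiltonian Λ (concat Λ ξ σ))
      fun ξ => f (concat Λ ξ σ) := by
  simp only [specAvg, specDensity, partitionFunction, boltzmannAvg, div_mul_eq_mul_div,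
    Finset.sum_div]

/-- `γ_Λ f` ignores the spins in `Λ`. -/
lemma specAvg_congr (Φ : Interaction E) {Λ : Finset ℤ} (f : (ℤ → E) → ℝ) {σ τ : ℤ → E}
    (hστ : ∀ i ∉ Λ, σ i = τ i) : Φ.specAvg Λ f σ = Φ.specAvg Λ f τ := by
  simp only [specAvg_eq_boltzmannAvg, concat_congr _ hστ]

lemma specDensity_nonneg (Φ : Interaction E) (Λ : Finset ℤ) (ξ : Λ → E) (σ : ℤ → E) :
    0 ≤ Φ.specDensity Λ ξ σ :=
  div_nonneg (Real.exp_pos _).le (Finset.sum_nonneg fun _ _ => (Real.exp_pos _).le)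

lemma sum_specDensity [Nonempty E] (Φ : Interaction E) (Λ : Finset ℤ) (σ : ℤ → E) :
    ∑ ξ : Λ → E, Φ.specDensity Λ ξ σ = 1 := by
  have h := Φ.specAvg_eq_boltzmannAvg Λ (fun _ => 1) σ
  rw [boltzmannAvg_const] at h
  simpa [specAvg] using h

lemma continuous_specDensity [Nonempty E] [TopologicalSpace E] [DiscreteTopology E]
    {Φ : Interaction E} (h : Φ.UniformlyAbsolutelyConvergent) (Λ : Finset ℤ) (ξ : Λ → E) :
    Continuous (Φ.specDensity Λ ξ) := by
  have hc : ∀ ξ : Λ → E, Continuous fun σ => Real.exp (-Φ.hamiltonian Λ (concat Λ ξ σ)) :=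
    fun ξ => Real.continuous_exp.comp
      ((continuous_hamiltonian h Λ).comp (continuous_concat Λ ξ)).neg
  exact (hc ξ).div (continuous_finsetSum _ fun ξ _ => hc ξ) fun σ => (sum_exp_neg_pos _).ne'

lemma continuous_specAvg [Nonempty E] [TopologicalSpace E] [DiscreteTopology E]
    {Φ : Interaction E} (h : Φ.UniformlyAbsolutelyConvergent) (Λ : Finset ℤ) {f : (ℤ → E) → ℝ}
    (hf : Continuous f) : Continuous (Φ.specAvg Λ f) :=
  continuous_finsetSum _ fun ξ _ =>
    (continuous_specDensity h Λ ξ).mul (hf.comp (continuous_concat Λ ξ))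

/-- Consistency of the specification: averaging first in a smaller volume does not change the
average in a larger one. The proof exchanges, in the double sum over a configuration in `Δ` and a
configuration in `Λ`, the latter with the restriction of the former to `Λ`. -/
lemma specAvg_specAvg [Nonempty E] {Φ : Interaction E} (h : Φ.UniformlyAbsolutelyConvergent)
    {Λ Δ : Finset ℤ} (hΛ : Λ ⊆ Δ) (f : (ℤ → E) → ℝ) (σ : ℤ → E) :
    Φ.specAvg Δ (Φ.specAvg Λ f) σ = Φ.specAvg Δ f σ := by
  classical
  -- `m ξ ζ` overwrites `ξ` by `ζ` on `Λ`
  let m : (Δ → E) → (Λ → E) → Δ → E := fun ξ ζ i => if hi : (i : ℤ) ∈ Λ then ζ ⟨i, hi⟩ else ξ i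
  let r : (Δ → E) → Λ → E := fun ξ i => ξ ⟨i, hΛ i.2⟩
  have hm : ∀ ξ ζ, concat Λ ζ (concat Δ ξ σ) = concat Δ (m ξ ζ) σ := fun ξ ζ => by
    ext i
    by_cases hi : i ∈ Λ
    · rw [concat_of_mem hi, concat_of_mem (hΛ hi)]
      simp [m, hi]
    · rw [concat_of_notMem hi]
      by_cases hi' : i ∈ Δ
      · rw [concat_of_mem hi', concat_of_mem hi']
        simp [m, hi]
      · rw [concat_of_notMem hi', concat_of_notMem hi']
  have hmr : ∀ ξ ζ, m (m ξ ζ) (r ξ) = ξ := fun ξ ζ => by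
    ext i; by_cases hi : (i : ℤ) ∈ Λ <;> simp [m, r, hi]
  have hrm : ∀ ξ ζ, r (m ξ ζ) = ζ := fun ξ ζ => by
    ext i; simp [m, r]
  have hmm : ∀ ξ ζ ζ', m (m ξ ζ) ζ' = m ξ ζ' := fun ξ ζ ζ' => by
    ext i; by_cases hi : (i : ℤ) ∈ Λ <;> simp [m, hi]
  let s : (Δ → E) × (Λ → E) ≃ (Δ → E) × (Λ → E) :=
    Function.Involutive.toPerm (fun p => (m p.1 p.2, r p.1)) fun p => by
      simp [hmr, hrm]
  have hs : ∀ p, s p = (m p.1 p.2, r p.1) := fun _ => rfl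
  set w : (Δ → E) → ℝ := fun ξ => Real.exp (-Φ.hamiltonian Δ (concat Δ ξ σ)) with hw
  set F : (Δ → E) → ℝ := fun ξ => f (concat Δ ξ σ) with hF
  have hin : ∀ ξ, Φ.specAvg Λ f (concat Δ ξ σ) =
      (∑ ζ, w (m ξ ζ) * F (m ξ ζ)) / ∑ ζ, w (m ξ ζ) := fun ξ => by
    rw [specAvg_eq_boltzmannAvg, boltzmannAvg_congr_add_const (h' := fun ζ : Λ → E =>
      Φ.hamiltonian Δ (concat Λ ζ (concat Δ ξ σ)))]
    · simp only [boltzmannAvg, hm, hw, hF]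
    · intro ζ ζ'
      have hζ : ∀ i ∉ Λ, concat Λ ζ (concat Δ ξ σ) i = concat Λ ζ' (concat Δ ξ σ) i :=
        fun i hi => by rw [concat_of_notMem hi, concat_of_notMem hi]
      rw [hamiltonian_sub_hamiltonian h subset_rfl hζ, hamiltonian_sub_hamiltonian h hΛ hζ]
  rw [specAvg_eq_boltzmannAvg, specAvg_eq_boltzmannAvg, boltzmannAvg, boltzmannAvg]
  congr 1
  simp only [hin]
  have hZ : ∀ ξ, 0 < ∑ ζ, w (m ξ ζ) := fun ξ =>
    Finset.sum_pos (fun _ _ => Real.exp_pos _) Finset.univ_nonempty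
  calc ∑ ξ, w ξ * ((∑ ζ, w (m ξ ζ) * F (m ξ ζ)) / ∑ ζ, w (m ξ ζ))
      = ∑ p : (Δ → E) × (Λ → E),
          w p.1 * (w (m p.1 p.2) * F (m p.1 p.2)) / ∑ ζ, w (m p.1 ζ) := by
        rw [Fintype.sum_prod_type]
        exact Finset.sum_congr rfl fun ξ _ => by rw [← mul_div_assoc, Finset.mul_sum, Finset.sum_div]
    _ = ∑ p : (Δ → E) × (Λ → E), w (m p.1 p.2) * (w p.1 * F p.1) / ∑ ζ, w (m p.1 ζ) := by
        rw [← Equiv.sum_comp s]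
        exact Finset.sum_congr rfl fun p _ => by
          simp only [hs, hmr, hmm]
    _ = ∑ ξ, w ξ * F ξ := by
        rw [Fintype.sum_prod_type]
        refine Finset.sum_congr rfl fun ξ _ => ?_
        dsimp only
        rw [← Finset.sum_div, ← Finset.sum_mul, mul_div_assoc, mul_div_cancel₀ _ (hZ ξ).ne']

end Specification

end Interaction

/-! ### Gibbs measures: test functions and existence -/

section Measures

variable {E : Type*} [Fintype E] [TopologicalSpace E] [DiscreteTopology E]
  [MeasurableSpace E] [BorelSpace E]

lemma integrable_of_continuous (μ : Measure (ℤ → E)) [IsFiniteMeasure μ] {f : (ℤ → E) → ℝ}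
    (hf : Continuous f) : Integrable f μ :=
  (BoundedContinuousFunction.mkOfCompact ⟨f, hf⟩).integrable μ

lemma tendsto_integral {ι : Type*} {l : Filter ι} {ν : ι → ProbabilityMeasure (ℤ → E)}
    {μ : ProbabilityMeasure (ℤ → E)} (h : Tendsto ν l (𝓝 μ)) {f : (ℤ → E) → ℝ}
    (hf : Continuous f) :
    Tendsto (fun i => ∫ σ, f σ ∂(ν i : Measure (ℤ → E))) l
      (𝓝 (∫ σ, f σ ∂(μ : Measure (ℤ → E)))) :=
  ProbabilityMeasure.tendsto_iff_forall_integral_tendsto.1 h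
    (BoundedContinuousFunction.mkOfCompact ⟨f, hf⟩)

lemma measure_ext_of_continuous {μ ν : Measure (ℤ → E)} [IsFiniteMeasure μ] [IsFiniteMeasure ν]
    (h : ∀ f : (ℤ → E) → ℝ, Continuous f → ∫ σ, f σ ∂μ = ∫ σ, f σ ∂ν) : μ = ν :=
  ext_of_forall_integral_eq_of_IsFiniteMeasure fun f => h f f.continuous

namespace Interaction

variable [Nonempty E]

/-- The image of `μ` under the specification kernel in the volume `Λ`. -/
noncomputable def specMeasure (Φ : Interaction E) (Λ : Finset ℤ) (μ : Measure (ℤ → E)) :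
    Measure (ℤ → E) :=
  ∑ ξ : Λ → E, (μ.withDensity fun σ => ENNReal.ofReal (Φ.specDensity Λ ξ σ)).map (concat Λ ξ)

lemma isFiniteMeasure_specMeasure {Φ : Interaction E} (h : Φ.UniformlyAbsolutelyConvergent)
    (Λ : Finset ℤ) (μ : Measure (ℤ → E)) [IsFiniteMeasure μ] :
    IsFiniteMeasure (Φ.specMeasure Λ μ) := by
  have : ∀ ξ : Λ → E, IsFiniteMeasure
      (μ.withDensity fun σ => ENNReal.ofReal (Φ.specDensity Λ ξ σ)) := fun ξ =>
    isFiniteMeasure_withDensity_ofReal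
      (integrable_of_continuous μ (continuous_specDensity h Λ ξ)).2
  unfold specMeasure
  infer_instance

lemma integral_specMeasure {Φ : Interaction E} (h : Φ.UniformlyAbsolutelyConvergent)
    (Λ : Finset ℤ) (μ : Measure (ℤ → E)) {f : (ℤ → E) → ℝ}
    (hf : Integrable f (Φ.specMeasure Λ μ)) :
    ∫ σ, f σ ∂Φ.specMeasure Λ μ = ∫ σ, Φ.specAvg Λ f σ ∂μ := by
  have hm : ∀ ξ : Λ → E, Measurable fun σ => ENNReal.ofReal (Φ.specDensity Λ ξ σ) := fun ξ =>
    (continuous_specDensity h Λ ξ).measurable.ennreal_ofReal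
  have hc : ∀ ξ : Λ → E, Measurable (concat Λ ξ : (ℤ → E) → ℤ → E) := fun ξ =>
    (continuous_concat Λ ξ).measurable
  have hfin : ∀ ξ : Λ → E, ∀ᵐ σ ∂μ, ENNReal.ofReal (Φ.specDensity Λ ξ σ) < ⊤ := fun ξ =>
    Eventually.of_forall fun σ => ENNReal.ofReal_lt_top
  have hfi := integrable_finsetSum_measure.1 hf
  have hfi' : ∀ ξ : Λ → E, Integrable (fun σ => Φ.specDensity Λ ξ σ * f (concat Λ ξ σ)) μ :=
    fun ξ => by
      have := (integrable_map_measure (hfi ξ (Finset.mem_univ ξ)).1 (hc ξ).aemeasurable).1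
        (hfi ξ (Finset.mem_univ ξ))
      rw [integrable_withDensity_iff_integrable_smul' (hm ξ) (hfin ξ)] at this
      simpa [ENNReal.toReal_ofReal (Φ.specDensity_nonneg Λ ξ _)] using this
  unfold specMeasure specAvg
  rw [integral_finsetSum_measure hfi, integral_finsetSum _ fun ξ _ => hfi' ξ]
  refine Finset.sum_congr rfl fun ξ _ => ?_
  rw [integral_map (hc ξ).aemeasurable (hfi ξ (Finset.mem_univ ξ)).1,
    integral_withDensity_eq_integral_toReal_smul (hm ξ) (hfin ξ)]
  simp [ENNReal.toReal_ofReal (Φ.specDensity_nonneg Λ ξ _)]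

/-- The DLR equations for continuous test functions imply those for all integrable ones. -/
lemma isGibbs_of_continuous {Φ : Interaction E} (h : Φ.UniformlyAbsolutelyConvergent)
    {μ : ProbabilityMeasure (ℤ → E)}
    (hμ : ∀ (Λ : Finset ℤ) (f : (ℤ → E) → ℝ), Continuous f →
      ∫ σ, Φ.specAvg Λ f σ ∂(μ : Measure (ℤ → E)) = ∫ σ, f σ ∂(μ : Measure (ℤ → E))) :
    Φ.IsGibbs μ := by
  intro Λ f hf
  have := isFiniteMeasure_specMeasure h Λ (μ : Measure (ℤ → E))
  have key : Φ.specMeasure Λ μ = μ := measure_ext_of_continuous fun g hg => by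
    rw [integral_specMeasure h Λ _ (integrable_of_continuous _ hg), hμ Λ g hg]
  rw [← integral_specMeasure h Λ _ (by rwa [key]), key]

/-- The finite-volume Gibbs measure in `Λ` with boundary condition `η`. -/
noncomputable def finiteVolumeMeasure (Φ : Interaction E) (η : ℤ → E) (Λ : Finset ℤ) :
    ProbabilityMeasure (ℤ → E) :=
  ⟨∑ ξ : Λ → E, ENNReal.ofReal (Φ.specDensity Λ ξ η) • Measure.dirac (concat Λ ξ η), ⟨by
    simp only [Measure.coe_finsetSum, Finset.sum_apply, Measure.smul_apply, measure_univ,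
      smul_eq_mul, mul_one]
    rw [← ENNReal.ofReal_sum_of_nonneg fun ξ _ => Φ.specDensity_nonneg Λ ξ η,
      Φ.sum_specDensity, ENNReal.ofReal_one]⟩⟩

lemma integral_finiteVolumeMeasure (Φ : Interaction E) (η : ℤ → E) (Λ : Finset ℤ)
    {f : (ℤ → E) → ℝ} (hf : Continuous f) :
    ∫ σ, f σ ∂(Φ.finiteVolumeMeasure η Λ : Measure (ℤ → E)) = Φ.specAvg Λ f η := by
  change ∫ σ, f σ ∂(∑ ξ : Λ → E,
    ENNReal.ofReal (Φ.specDensity Λ ξ η) • Measure.dirac (concat Λ ξ η)) = _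
  rw [integral_finsetSum_measure fun ξ _ =>
    (integrable_of_continuous _ hf).smul_measure ENNReal.ofReal_ne_top]
  refine Finset.sum_congr rfl fun ξ _ => ?_
  rw [integral_smul_measure, integral_dirac,
    ENNReal.toReal_ofReal (Φ.specDensity_nonneg Λ ξ η), smul_eq_mul]

/-- Limit points of finite-volume Gibbs measures, which exist by compactness, are Gibbs. -/
lemma exists_isGibbs {Φ : Interaction E} (h : Φ.UniformlyAbsolutelyConvergent) :
    ∃ μ : ProbabilityMeasure (ℤ → E), Φ.IsGibbs μ := by
  obtain ⟨η⟩ : Nonempty (ℤ → E) := inferInstance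
  obtain ⟨μ, hμ⟩ := exists_clusterPt_of_compactSpace (map (Φ.finiteVolumeMeasure η) atTop)
  obtain ⟨U, hU, hlim⟩ := mapClusterPt_iff_ultrafilter.1 hμ
  refine ⟨μ, isGibbs_of_continuous h fun Λ f hf => ?_⟩
  refine tendsto_nhds_unique (tendsto_integral hlim (continuous_specAvg h Λ hf))
    ((tendsto_integral hlim hf).congr' ?_)
  filter_upwards [hU (eventually_ge_atTop Λ)] with Δ hΔ
  rw [integral_finiteVolumeMeasure _ _ _ hf,
    integral_finiteVolumeMeasure _ _ _ (continuous_specAvg h Λ hf), specAvg_specAvg h hΔ]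

end Interaction

end Measures

/-! ### Site oscillations and the interdependence matrix -/

section Oscillation

variable {E : Type*}

/-- The oscillation of `f` at the site `j`: the largest change of `f` under a change of the spin
at `j`. -/
noncomputable def siteOscillation (j : ℤ) (f : (ℤ → E) → ℝ) : ℝ≥0∞ :=
  ⨆ ξ : ℤ → E, ⨆ η : ℤ → E, ⨆ _ : ∀ i ≠ j, ξ i = η i, ‖f ξ - f η‖ₑ

lemma enorm_sub_le_siteOscillation {j : ℤ} (f : (ℤ → E) → ℝ) {ξ η : ℤ → E}
    (h : ∀ i ≠ j, ξ i = η i) : ‖f ξ - f η‖ₑ ≤ siteOscillation j f :=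
  le_iSup_of_le ξ (le_iSup_of_le η (le_iSup_of_le h le_rfl))

lemma siteOscillation_le {j : ℤ} {f : (ℤ → E) → ℝ} {C : ℝ≥0∞}
    (h : ∀ ξ η : ℤ → E, (∀ i ≠ j, ξ i = η i) → ‖f ξ - f η‖ₑ ≤ C) : siteOscillation j f ≤ C :=
  iSup_le fun ξ => iSup_le fun η => iSup_le fun hξη => h ξ η hξη

/-- For functions of finitely many spins this is a telescoping sum; continuous functions are limits
of such functions. -/
lemma enorm_sub_le_tsum_siteOscillation [TopologicalSpace E] {f : (ℤ → E) → ℝ} (hf : Continuous f)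
    (ξ η : ℤ → E) : ‖f ξ - f η‖ₑ ≤ ∑' j, siteOscillation j f := by
  have hfin : ∀ S : Finset ℤ, ‖f (S.piecewise ξ η) - f η‖ₑ ≤ ∑ j ∈ S, siteOscillation j f := by
    intro S
    induction S using Finset.induction_on with
    | empty => simp
    | insert j S hj ih =>
      rw [Finset.sum_insert hj]
      calc ‖f ((insert j S).piecewise ξ η) - f η‖ₑ
          = ‖(f ((insert j S).piecewise ξ η) - f (S.piecewise ξ η))
              + (f (S.piecewise ξ η) - f η)‖ₑ := by rw [sub_add_sub_cancel]
        _ ≤ _ := (enorm_add_le _ _).trans (add_le_add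
            (enorm_sub_le_siteOscillation f fun i hi =>
              Finset.piecewise_insert_of_ne S ξ η hi) ih)
  have hlim : Tendsto (fun S : Finset ℤ => S.piecewise ξ η) atTop (𝓝 ξ) :=
    tendsto_pi_nhds.2 fun i => tendsto_const_nhds.congr' <| by
      filter_upwards [eventually_ge_atTop {i}] with S hS
      rw [Finset.piecewise_eq_of_mem _ _ _ (Finset.singleton_subset_iff.1 hS)]
  exact le_of_tendsto (((hf.tendsto ξ).comp hlim).sub_const (f η)).enorm
    (Eventually.of_forall fun S => (hfin S).trans (ENNReal.sum_le_tsum S))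

namespace Interaction

/-- The bound for Dobrushin's interdependence matrix: its entry at `(i, j)` controls the dependence
of the single-spin distribution at `i` on the spin at `j`. -/
noncomputable def interdependence (Φ : Interaction E) (i j : ℤ) : ℝ≥0∞ :=
  2⁻¹ * ∑' V : Finset ℤ, if i ∈ V ∧ j ∈ V ∧ j ≠ i then oscillation (Φ.pot V) else 0

lemma tsum_interdependence_le (Φ : Interaction E) (i : ℤ) :
    ∑' j, Φ.interdependence i j ≤ Φ.dobrushinConstant := by
  unfold interdependence dobrushinConstant
  rw [ENNReal.tsum_mul_left, ENNReal.tsum_comm]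
  gcongr
  refine le_trans (le_of_eq ?_) (le_iSup (fun i : ℤ => ∑' Λ : {Λ : Finset ℤ // i ∈ Λ},
    ((Λ.1.card - 1 : ℕ) : ℝ≥0∞) * oscillation (Φ.pot Λ)) i)
  refine Eq.trans ?_ (tsum_subtype {Λ : Finset ℤ | i ∈ Λ} fun Λ =>
    ((Λ.card - 1 : ℕ) : ℝ≥0∞) * oscillation (Φ.pot Λ)).symm
  refine tsum_congr fun V => ?_
  by_cases hi : i ∈ V
  · rw [Set.indicator_of_mem (show V ∈ {Λ : Finset ℤ | i ∈ Λ} from hi),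
      tsum_eq_sum (s := V.erase i) fun j hj => if_neg fun h =>
        hj (Finset.mem_erase.2 ⟨h.2.2, h.2.1⟩),
      Finset.sum_congr rfl fun j hj => if_pos
        ⟨hi, (Finset.mem_erase.1 hj).2, (Finset.mem_erase.1 hj).1⟩,
      Finset.sum_const, Finset.card_erase_of_mem hi, nsmul_eq_mul]
  · rw [Set.indicator_of_notMem (show V ∉ {Λ : Finset ℤ | i ∈ Λ} from hi)]
    simp [hi]

lemma enorm_hamiltonian_singleton_sub_le {Φ : Interaction E}
    (h : Φ.UniformlyAbsolutelyConvergent) {i j : ℤ} (hij : j ≠ i) {σ τ : ℤ → E}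
    (hστ : ∀ l ≠ j, σ l = τ l) :
    ‖Φ.hamiltonian {i} σ - Φ.hamiltonian {i} τ‖ₑ ≤
      ∑' V : Finset ℤ, if i ∈ V ∧ j ∈ V ∧ j ≠ i then oscillation (Φ.pot V) else 0 := by
  rw [hamiltonian, hamiltonian, ← (summable_pot h {i} σ).tsum_sub (summable_pot h {i} τ)]
  refine enorm_tsum_le_tsum_enorm.trans (le_trans (ENNReal.tsum_le_tsum fun V => ?_)
    (ENNReal.tsum_comp_le_tsum_of_injective (Subtype.val_injective
      (p := fun V : Finset ℤ => (V ∩ {i}).Nonempty)) _))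
  have hi : i ∈ V.1 := by
    obtain ⟨l, hl⟩ := V.2
    rw [Finset.mem_inter, Finset.mem_singleton] at hl
    exact hl.2 ▸ hl.1
  by_cases hj : j ∈ V.1
  · rw [if_pos ⟨hi, hj, hij⟩]
    exact enorm_sub_le_oscillation _ σ τ
  · rw [Φ.isLocal V σ τ fun l hl => hστ l fun h => hj (h ▸ hl), sub_self, enorm_zero]
    exact zero_le

lemma siteOscillation_specAvg_self [Fintype E] (Φ : Interaction E) (i : ℤ) (f : (ℤ → E) → ℝ) :
    siteOscillation i (Φ.specAvg {i} f) = 0 := by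
  refine le_antisymm (siteOscillation_le fun σ τ h => ?_) zero_le
  rw [Φ.specAvg_congr f fun l hl => h l (by simpa using hl), sub_self, enorm_zero]

/-- Averaging over the spin at `i` transports the oscillation at `i` to the other sites, with the
weights of the interdependence matrix. -/
lemma siteOscillation_specAvg_le [Fintype E] [Nonempty E] {Φ : Interaction E}
    (h : Φ.UniformlyAbsolutelyConvergent) {i j : ℤ} (hij : j ≠ i) (f : (ℤ → E) → ℝ) :
    siteOscillation j (Φ.specAvg {i} f) ≤
      siteOscillation j f + Φ.interdependence i j * siteOscillation i f := by
  refine siteOscillation_le fun σ τ hστ => ?_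
  have hc : ∀ ξ : ({i} : Finset ℤ) → E, ∀ l ≠ j, concat {i} ξ σ l = concat {i} ξ τ l := by
    intro ξ l hl
    by_cases hli : l ∈ ({i} : Finset ℤ)
    · rw [concat_of_mem hli, concat_of_mem hli]
    · rw [concat_of_notMem hli, concat_of_notMem hli, hστ l hl]
  have hi : ∀ ξ ξ' : ({i} : Finset ℤ) → E, ∀ l ≠ i, concat {i} ξ τ l = concat {i} ξ' τ l := by
    intro ξ ξ' l hl
    rw [concat_of_notMem (by simpa using hl), concat_of_notMem (by simpa using hl)]
  set hσ := fun ξ : ({i} : Finset ℤ) → E => Φ.hamiltonian {i} (concat {i} ξ σ)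
  set hτ := fun ξ : ({i} : Finset ℤ) → E => Φ.hamiltonian {i} (concat {i} ξ τ)
  calc ‖Φ.specAvg {i} f σ - Φ.specAvg {i} f τ‖ₑ
      = ‖boltzmannAvg hσ (fun ξ => f (concat {i} ξ σ) - f (concat {i} ξ τ))
          + (boltzmannAvg hσ (fun ξ => f (concat {i} ξ τ))
            - boltzmannAvg hτ (fun ξ => f (concat {i} ξ τ)))‖ₑ := by
        rw [boltzmannAvg_sub, sub_add_sub_cancel, specAvg_eq_boltzmannAvg,
          specAvg_eq_boltzmannAvg]
    _ ≤ _ := (enorm_add_le _ _).trans (add_le_add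
        (enorm_boltzmannAvg_le _ fun ξ => enorm_sub_le_siteOscillation f (hc ξ))
        (enorm_boltzmannAvg_sub_le
          (fun ξ => enorm_hamiltonian_singleton_sub_le h hij (hc ξ))
          fun ξ ξ' => enorm_sub_le_siteOscillation f (hi ξ ξ')))

end Interaction

end Oscillation

/-! ### Dobrushin uniqueness -/

section Uniqueness

variable {E : Type*} [Fintype E] [TopologicalSpace E] [DiscreteTopology E]
  [MeasurableSpace E] [BorelSpace E]

/-- The weights `a` form an estimate for the pair `μ, ν`: the integrals of a continuous `f` differ
by at most the sum of the site oscillations of `f`, weighted by `a`. -/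
def IsEstimate (μ ν : ProbabilityMeasure (ℤ → E)) (a : ℤ → ℝ≥0∞) : Prop :=
  ∀ f : (ℤ → E) → ℝ, Continuous f →
    ‖∫ σ, f σ ∂(μ : Measure (ℤ → E)) - ∫ σ, f σ ∂(ν : Measure (ℤ → E))‖ₑ ≤
      ∑' j, a j * siteOscillation j f

lemma isEstimate_two (μ ν : ProbabilityMeasure (ℤ → E)) : IsEstimate μ ν fun _ => 2 := by
  intro f hf
  rw [ENNReal.tsum_mul_left]
  obtain ⟨η⟩ : Nonempty (ℤ → E) := nonempty_of_isProbabilityMeasure (μ : Measure (ℤ → E))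
  have key : ∀ ρ : ProbabilityMeasure (ℤ → E),
      ‖∫ σ, f σ ∂(ρ : Measure (ℤ → E)) - f η‖ₑ ≤ ∑' j, siteOscillation j f := fun ρ => by
    have : ∫ σ, f σ ∂(ρ : Measure (ℤ → E)) - f η = ∫ σ, (f σ - f η) ∂(ρ : Measure (ℤ → E)) := by
      rw [integral_sub (integrable_of_continuous _ hf) (integrable_const _)]
      simp
    rw [this]
    refine (enorm_integral_le_lintegral_enorm _).trans ?_
    calc ∫⁻ σ, ‖f σ - f η‖ₑ ∂(ρ : Measure (ℤ → E))
        ≤ ∫⁻ _, (∑' j, siteOscillation j f) ∂(ρ : Measure (ℤ → E)) :=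
          lintegral_mono fun σ => enorm_sub_le_tsum_siteOscillation hf σ η
      _ = _ := by simp
  rw [← sub_sub_sub_cancel_right _ _ (f η), two_mul]
  exact (enorm_sub_le).trans (add_le_add (key μ) (key ν))

/-- One step of Dobrushin's dusting argument: the weight at `i` of an estimate for two Gibbs
measures may be replaced by the average of all weights by the interdependence matrix. -/
lemma IsEstimate.update [Nonempty E] {Φ : Interaction E} (h : Φ.UniformlyAbsolutelyConvergent)
    {μ ν : ProbabilityMeasure (ℤ → E)} (hμ : Φ.IsGibbs μ) (hν : Φ.IsGibbs ν) {a : ℤ → ℝ≥0∞}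
    (ha : IsEstimate μ ν a) (i : ℤ) :
    IsEstimate μ ν (Function.update a i (∑' j, Φ.interdependence i j * a j)) := by
  intro f hf
  rw [← hμ {i} f (integrable_of_continuous _ hf), ← hν {i} f (integrable_of_continuous _ hf)]
  refine (ha _ (Interaction.continuous_specAvg h {i} hf)).trans ?_
  rw [ENNReal.tsum_eq_add_tsum_ite (f := fun j => Function.update a i
    (∑' j, Φ.interdependence i j * a j) j * siteOscillation j f) i, Function.update_self,
    ← ENNReal.tsum_mul_right, ← ENNReal.tsum_add]
  refine ENNReal.tsum_le_tsum fun j => ?_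
  split_ifs with hj
  · rw [hj, Φ.siteOscillation_specAvg_self, mul_zero]
    exact zero_le
  · rw [Function.update_of_ne hj]
    calc a j * siteOscillation j (Φ.specAvg {i} f)
        ≤ a j * (siteOscillation j f + Φ.interdependence i j * siteOscillation i f) := by
          gcongr
          exact Interaction.siteOscillation_specAvg_le h hj f
      _ = _ := by ring

lemma IsEstimate.mul_on_finset [Nonempty E] {Φ : Interaction E}
    (h : Φ.UniformlyAbsolutelyConvergent) {μ ν : ProbabilityMeasure (ℤ → E)} (hμ : Φ.IsGibbs μ)
    (hν : Φ.IsGibbs ν) {α c : ℝ≥0∞} (hα : Φ.dobrushinConstant ≤ α) (hα' : α ≤ 1)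
    (hc : IsEstimate μ ν fun _ => c) (S : Finset ℤ) :
    IsEstimate μ ν fun j => if j ∈ S then α * c else c := by
  induction S using Finset.induction_on with
  | empty => simpa using hc
  | insert i S hi ih =>
    refine fun f hf => (ih.update h hμ hν i f hf).trans
      (ENNReal.tsum_le_tsum fun j => mul_le_mul_left ?_ _)
    dsimp only
    by_cases hj : j = i
    · subst hj
      rw [Function.update_self, if_pos (Finset.mem_insert_self j S)]
      calc ∑' l, Φ.interdependence j l * (if l ∈ S then α * c else c)
          ≤ ∑' l, Φ.interdependence j l * c := by
            refine ENNReal.tsum_le_tsum fun l => ?_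
            gcongr
            split_ifs
            · exact mul_le_of_le_one_left' hα'
            · exact le_rfl
        _ ≤ α * c := by
            rw [ENNReal.tsum_mul_right]
            gcongr
            exact (Φ.tsum_interdependence_le j).trans hα
    · rw [Function.update_of_ne hj]
      simp [hj]

/-- Updating the weights at all sites multiplies a constant estimate by `α`. -/
lemma IsEstimate.mul [Nonempty E] {Φ : Interaction E}
    (h : Φ.UniformlyAbsolutelyConvergent) {μ ν : ProbabilityMeasure (ℤ → E)} (hμ : Φ.IsGibbs μ)
    (hν : Φ.IsGibbs ν) {α c : ℝ≥0∞} (hα : Φ.dobrushinConstant ≤ α) (hα' : α ≤ 1) (hα₀ : α ≠ 0)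
    (hc : IsEstimate μ ν fun _ => c) : IsEstimate μ ν fun _ => α * c := by
  intro f hf
  by_cases hfin : ∑' j, c * siteOscillation j f = ⊤
  · rw [ENNReal.tsum_mul_left] at hfin ⊢
    rw [mul_assoc, hfin, ENNReal.mul_top hα₀]
    exact le_top
  have hlim := (ENNReal.tendsto_tsum_compl_atTop_zero hfin).const_add
    (∑' j, α * c * siteOscillation j f)
  rw [add_zero] at hlim
  refine ge_of_tendsto' hlim fun S => (hc.mul_on_finset h hμ hν hα hα' S f hf).trans ?_
  have e : ∑' j : {j // j ∉ S}, c * siteOscillation j f =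
      ∑' j, {j | j ∉ S}.indicator (fun j => c * siteOscillation j f) j :=
    tsum_subtype {j | j ∉ S} fun j => c * siteOscillation j f
  rw [e, ← ENNReal.tsum_add]
  refine ENNReal.tsum_le_tsum fun j => ?_
  dsimp only
  by_cases hj : j ∈ S
  · rw [if_pos hj]
    exact le_self_add
  · rw [if_neg hj, Set.indicator_of_mem (show j ∈ {j | j ∉ S} from hj)]
    exact le_add_self

/-- Integrals of `f` are limits of those of the functions obtained from `f` by freezing the spins
outside large finite sets. -/
lemma tendsto_integral_concat (μ : ProbabilityMeasure (ℤ → E)) (η : ℤ → E) {f : (ℤ → E) → ℝ}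
    (hf : Continuous f) :
    Tendsto (fun S : Finset ℤ => ∫ σ, f (concat S (fun i => σ i) η) ∂(μ : Measure (ℤ → E))) atTop
      (𝓝 (∫ σ, f σ ∂(μ : Measure (ℤ → E)))) := by
  obtain ⟨C, hC⟩ := (isCompact_range hf).isBounded.exists_norm_le
  refine tendsto_integral_filter_of_dominated_convergence (fun _ => C) ?_ ?_
    (integrable_const _) ?_
  · refine Eventually.of_forall fun S => Continuous.aestronglyMeasurable (hf.comp ?_)
    refine continuous_pi fun i => ?_
    by_cases hi : i ∈ S
    · simp only [concat_of_mem hi, continuous_apply i]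
    · simp only [concat_of_notMem hi, continuous_const]
  · exact Eventually.of_forall fun S => Eventually.of_forall fun σ => hC _ ⟨_, rfl⟩
  · refine Eventually.of_forall fun σ => (hf.tendsto σ).comp (tendsto_pi_nhds.2 fun i =>
      tendsto_const_nhds.congr' ?_)
    filter_upwards [eventually_ge_atTop {i}] with S hS
    rw [concat_of_mem (Finset.singleton_subset_iff.1 hS)]

/-- Dobrushin's uniqueness theorem. -/
theorem Interaction.IsGibbs.eq [Nonempty E] {Φ : Interaction E}
    (h : Φ.UniformlyAbsolutelyConvergent) (hD : Φ.dobrushinConstant < 1)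
    {μ ν : ProbabilityMeasure (ℤ → E)} (hμ : Φ.IsGibbs μ) (hν : Φ.IsGibbs ν) : μ = ν := by
  -- strictly above the Dobrushin constant, so that `α ≠ 0`
  obtain ⟨α, hα, hα'⟩ := exists_between hD
  have hα₀ : α ≠ 0 := (zero_le.trans_lt hα).ne'
  have hpow : ∀ n : ℕ, IsEstimate μ ν fun _ => α ^ n * 2 := by
    intro n
    induction n with
    | zero => simpa using isEstimate_two μ ν
    | succ n ih =>
      have := ih.mul h hμ hν hα.le hα'.le hα₀
      simpa [pow_succ', mul_assoc] using this
  have heq : ∀ f : (ℤ → E) → ℝ, Continuous f → ∑' j, siteOscillation j f ≠ ⊤ →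
      ∫ σ, f σ ∂(μ : Measure (ℤ → E)) = ∫ σ, f σ ∂(ν : Measure (ℤ → E)) := by
    intro f hf hfin
    have hlim : Tendsto (fun n : ℕ => α ^ n * (2 * ∑' j, siteOscillation j f)) atTop (𝓝 0) := by
      have := ENNReal.Tendsto.mul_const (b := 2 * ∑' j, siteOscillation j f)
        (ENNReal.tendsto_pow_atTop_nhds_zero_of_lt_one hα')
        (Or.inr (ENNReal.mul_ne_top ENNReal.ofNat_ne_top hfin))
      rwa [zero_mul] at this
    have hle := ge_of_tendsto' hlim fun n => by
      have := hpow n f hf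
      rwa [ENNReal.tsum_mul_left, mul_assoc] at this
    exact sub_eq_zero.1 (enorm_eq_zero.1 (le_antisymm hle zero_le))
  obtain ⟨η⟩ : Nonempty (ℤ → E) := inferInstance
  refine ProbabilityMeasure.toMeasure_injective (measure_ext_of_continuous fun f hf => ?_)
  refine tendsto_nhds_unique (tendsto_integral_concat μ η hf)
    ((tendsto_integral_concat ν η hf).congr fun S => ?_)
  set g : (ℤ → E) → ℝ := fun σ => f (concat S (fun i => σ i) η) with hg
  have hgc : Continuous g := by
    refine hf.comp (continuous_pi fun i => ?_)
    by_cases hi : i ∈ S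
    · simp only [concat_of_mem hi, continuous_apply i]
    · simp only [concat_of_notMem hi, continuous_const]
  refine (heq g hgc ?_).symm
  obtain ⟨C, hC⟩ := (isCompact_range hgc).isBounded.exists_norm_le
  rw [tsum_eq_sum (s := S) fun j hj => ?_]
  · refine ENNReal.sum_ne_top.2 fun j _ => ne_top_of_le_ne_top
      (ENNReal.ofReal_ne_top (r := C + C)) (siteOscillation_le fun σ τ _ => ?_)
    rw [← ofReal_norm]
    exact ENNReal.ofReal_le_ofReal ((norm_sub_le _ _).trans
      (add_le_add (hC _ ⟨_, rfl⟩) (hC _ ⟨_, rfl⟩)))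
  · refine le_antisymm (siteOscillation_le fun σ τ hστ => ?_) zero_le
    have : (fun i : S => σ i) = fun i : S => τ i :=
      funext fun i => hστ i fun h => hj (h ▸ i.2)
    simp only [hg, this, sub_self, enorm_zero, le_refl]

end Uniqueness

/-! ### The intermediate interactions -/

namespace Interaction

section Intermediate

variable {E : Type*} (Φ : Interaction E) (e : ℕ ≃ crossingSets)

lemma intermediate_pot_eq_zero_or (k : ℕ) (V : Finset ℤ) :
    (Φ.intermediate e k).pot V = (fun _ => 0) ∨ (Φ.intermediate e k).pot V = Φ.pot V := by
  by_cases h : ∃ j, k ≤ j ∧ (e j : Finset ℤ) = V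
  · exact Or.inl (funext fun σ => if_pos h)
  · exact Or.inr (funext fun σ => if_neg h)

lemma supNorm_intermediate_le (k : ℕ) (V : Finset ℤ) :
    supNorm ((Φ.intermediate e k).pot V) ≤ supNorm (Φ.pot V) := by
  rcases Φ.intermediate_pot_eq_zero_or e k V with h | h <;> rw [h]
  simp [supNorm]

lemma oscillation_intermediate_le (k : ℕ) (V : Finset ℤ) :
    oscillation ((Φ.intermediate e k).pot V) ≤ oscillation (Φ.pot V) := by
  rcases Φ.intermediate_pot_eq_zero_or e k V with h | h <;> rw [h]
  simp [oscillation]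

lemma dobrushinConstant_intermediate_le (k : ℕ) :
    (Φ.intermediate e k).dobrushinConstant ≤ Φ.dobrushinConstant := by
  unfold dobrushinConstant
  gcongr
  exact oscillation_intermediate_le Φ e k _

variable {Φ}

lemma UniformlyAbsolutelyConvergent.intermediate (h : Φ.UniformlyAbsolutelyConvergent) (k : ℕ) :
    (Φ.intermediate e k).UniformlyAbsolutelyConvergent :=
  lt_of_le_of_lt (iSup_mono fun _ => ENNReal.tsum_le_tsum fun V =>
    supNorm_intermediate_le Φ e k V) h

variable (Φ)

lemma intermediate_pot_eq_add (k : ℕ) (V : Finset ℤ) (σ : ℤ → E) :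
    (Φ.intermediate e k).pot V σ = (Φ.intermediate e 0).pot V σ +
      ∑ j ∈ Finset.range k, if V = (e j : Finset ℤ) then Φ.pot V σ else 0 := by
  by_cases hV : ∃ i, (e i : Finset ℤ) = V
  · obtain ⟨i, rfl⟩ := hV
    have hinj : ∀ j, (e i : Finset ℤ) = (e j : Finset ℤ) ↔ i = j := fun j => by
      rw [Subtype.coe_inj, e.apply_eq_iff_eq]
    have hk : (∃ j, k ≤ j ∧ (e j : Finset ℤ) = e i) ↔ k ≤ i :=
      ⟨fun ⟨j, hj, h⟩ => (hinj j).1 h.symm ▸ hj, fun h => ⟨i, h, rfl⟩⟩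
    have h0 : ∃ j, 0 ≤ j ∧ (e j : Finset ℤ) = e i := ⟨i, Nat.zero_le i, rfl⟩
    simp only [intermediate, if_pos h0, hk, hinj, Finset.sum_ite_eq, Finset.mem_range, zero_add]
    by_cases h : k ≤ i
    · rw [if_pos h, if_neg (by omega)]
    · rw [if_neg h, if_pos (by omega)]
  · have hk : ∀ k, ¬ ∃ j, k ≤ j ∧ (e j : Finset ℤ) = V := fun k ⟨j, _, h⟩ => hV ⟨j, h⟩
    have hne : ∀ j, V ≠ (e j : Finset ℤ) := fun j h => hV ⟨j, h.symm⟩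
    simp only [intermediate, if_neg (hk _), if_neg (hne _), Finset.sum_const_zero, add_zero]

variable {Φ}

/-- The interaction `Ψ^(k)` adds to `Ψ^(0)` the bounded energy of the first `k` crossing sets. -/
lemma hamiltonian_intermediate_sub (h : Φ.UniformlyAbsolutelyConvergent) (k : ℕ) (Λ : Finset ℤ)
    {σ τ : ℤ → E} (hστ : ∀ i ∉ Λ, σ i = τ i) :
    (Φ.intermediate e k).hamiltonian Λ σ - (Φ.intermediate e k).hamiltonian Λ τ =
      (Φ.intermediate e 0).hamiltonian Λ σ - (Φ.intermediate e 0).hamiltonian Λ τ +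
        (∑ j ∈ Finset.range k, Φ.pot (e j) σ - ∑ j ∈ Finset.range k, Φ.pot (e j) τ) := by
  rw [hamiltonian_sub_hamiltonian (h.intermediate e k) subset_rfl hστ,
    hamiltonian_sub_hamiltonian (h.intermediate e 0) subset_rfl hστ, ← Finset.sum_sub_distrib]
  have hs : ∀ j ∈ Finset.range k, HasSum
      (fun V : Finset ℤ => if V = (e j : Finset ℤ) then Φ.pot V σ - Φ.pot V τ else 0)
      (Φ.pot (e j) σ - Φ.pot (e j) τ) := fun j _ => by
    have := hasSum_ite_eq (e j : Finset ℤ) (Φ.pot (e j) σ - Φ.pot (e j) τ)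
    refine this.congr_fun fun V => ?_
    split_ifs with hV
    · rw [hV]
    · rfl
  have h0 := (summable_pot_sub (h.intermediate e 0) hστ).hasSum
  refine ((h0.add (hasSum_sum hs)).congr_fun fun V => ?_).tsum_eq
  rw [Φ.intermediate_pot_eq_add e k V σ, Φ.intermediate_pot_eq_add e k V τ,
    add_sub_add_comm, ← Finset.sum_sub_distrib]
  congr 1
  refine Finset.sum_congr rfl fun j _ => ?_
  split_ifs <;> simp

/-- The Hamiltonians of the intermediate interactions converge uniformly to the full one. -/
lemma exists_abs_hamiltonian_intermediate_sub_le (h : Φ.UniformlyAbsolutelyConvergent)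
    (Λ : Finset ℤ) : ∃ D : ℕ → ℝ, Tendsto D atTop (𝓝 0) ∧
      ∀ k σ, |(Φ.intermediate e k).hamiltonian Λ σ - Φ.hamiltonian Λ σ| ≤ D k := by
  classical
  let t : ℕ → {V : Finset ℤ // (V ∩ Λ).Nonempty} → ℝ := fun k V =>
    if ∃ j, k ≤ j ∧ (e j : Finset ℤ) = V then (supNorm (Φ.pot V)).toReal else 0
  have hsum := summable_toReal_supNorm h Λ
  have ht : ∀ k V, ‖t k V‖ ≤ (supNorm (Φ.pot V)).toReal := fun k V => by
    by_cases hV : ∃ j, k ≤ j ∧ (e j : Finset ℤ) = V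
    · simp only [t, if_pos hV, Real.norm_eq_abs, abs_of_nonneg ENNReal.toReal_nonneg, le_refl]
    · simp only [t, if_neg hV, norm_zero, ENNReal.toReal_nonneg]
  refine ⟨fun k => ∑' V, t k V, ?_, fun k σ => ?_⟩
  · rw [← tsum_zero (α := ℝ) (β := {V : Finset ℤ // (V ∩ Λ).Nonempty})]
    refine tendsto_tsum_of_dominated_convergence hsum (fun V => ?_)
      (Eventually.of_forall fun k V => ht k V)
    -- each set leaves the tails of the enumeration
    refine tendsto_const_nhds.congr' ?_
    by_cases hV : ∃ i, (e i : Finset ℤ) = V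
    · obtain ⟨i, hi⟩ := hV
      filter_upwards [eventually_gt_atTop i] with k hk
      refine (if_neg ?_).symm
      rintro ⟨j, hj, hjV⟩
      have : j = i := e.injective (Subtype.ext (hjV.trans hi.symm))
      omega
    · exact Eventually.of_forall fun k => (if_neg fun ⟨j, _, hj⟩ => hV ⟨j, hj⟩).symm
  · rw [hamiltonian, hamiltonian,
      ← (summable_pot (h.intermediate e k) Λ σ).tsum_sub (summable_pot h Λ σ)]
    refine tsum_of_norm_bounded (f := fun V : {V : Finset ℤ // (V ∩ Λ).Nonempty} =>
      (Φ.intermediate e k).pot V σ - Φ.pot V σ)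
      (Summable.of_norm_bounded hsum (ht k)).hasSum fun V => ?_
    by_cases hV : ∃ j, k ≤ j ∧ (e j : Finset ℤ) = V
    · simpa only [t, intermediate, if_pos hV, zero_sub, norm_neg] using norm_pot_le h V σ
    · simp only [t, intermediate, if_neg hV, sub_self, norm_zero, le_refl]

end Intermediate

end Interaction

/-! ### Changes of density and limits -/

section Limits

variable {E : Type*} [Fintype E] [TopologicalSpace E] [DiscreteTopology E]
  [MeasurableSpace E] [BorelSpace E]

namespace Interaction

/-- If the energies of `Ψ` are those of `Φ` plus a continuous function `W`, then the density
`exp (-W)`, normalized, turns Gibbs measures for `Φ` into Gibbs measures for `Ψ`. -/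
lemma IsGibbs.tilted [Nonempty E] {Φ Ψ : Interaction E} (hΨ : Ψ.UniformlyAbsolutelyConvergent)
    {W : (ℤ → E) → ℝ} (hW : Continuous W)
    (hH : ∀ (Λ : Finset ℤ) (σ τ : ℤ → E), (∀ i ∉ Λ, σ i = τ i) →
      Ψ.hamiltonian Λ σ - Ψ.hamiltonian Λ τ =
        Φ.hamiltonian Λ σ - Φ.hamiltonian Λ τ + (W σ - W τ))
    {μ : ProbabilityMeasure (ℤ → E)} (hμ : Φ.IsGibbs μ) :
    Ψ.IsGibbs ⟨(μ : Measure (ℤ → E)).tilted fun σ => -W σ,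
      isProbabilityMeasure_tilted (integrable_of_continuous _ (by fun_prop))⟩ := by
  have hexp : Continuous fun σ => Real.exp (-W σ) := by fun_prop
  have hloc : ∀ (Λ : Finset ℤ) (f : (ℤ → E) → ℝ) (σ : ℤ → E),
      Φ.specAvg Λ (fun σ => f σ * Real.exp (-W σ)) σ =
        Ψ.specAvg Λ f σ * Φ.specAvg Λ (fun σ => Real.exp (-W σ)) σ := fun Λ f σ => by
    simp only [specAvg_eq_boltzmannAvg]
    rw [boltzmannAvg_mul_exp]
    congr 1
    refine boltzmannAvg_congr_add_const _ fun ξ ξ' => ?_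
    have := hH Λ (concat Λ ξ σ) (concat Λ ξ' σ) fun i hi => by
      rw [concat_of_notMem hi, concat_of_notMem hi]
    linarith
  refine isGibbs_of_continuous hΨ fun Λ f hf => ?_
  have key : ∫ σ, Ψ.specAvg Λ f σ * Real.exp (-W σ) ∂(μ : Measure (ℤ → E)) =
      ∫ σ, f σ * Real.exp (-W σ) ∂(μ : Measure (ℤ → E)) := by
    rw [← hμ Λ (fun σ => Ψ.specAvg Λ f σ * Real.exp (-W σ))
        (integrable_of_continuous _ ((continuous_specAvg hΨ Λ hf).mul hexp)),
      ← hμ Λ (fun σ => f σ * Real.exp (-W σ)) (integrable_of_continuous _ (hf.mul hexp))]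
    simp only [hloc, specAvg_specAvg hΨ subset_rfl]
  change ∫ σ, Ψ.specAvg Λ f σ ∂(μ : Measure (ℤ → E)).tilted (fun σ => -W σ) =
    ∫ σ, f σ ∂(μ : Measure (ℤ → E)).tilted (fun σ => -W σ)
  rw [integral_tilted, integral_tilted]
  simp only [smul_eq_mul, div_mul_eq_mul_div, integral_div, mul_comm (Real.exp _), key]

/-- Gibbs measures pass to weak limits along interactions whose Hamiltonians converge uniformly. -/
lemma isGibbs_of_tendsto [Nonempty E] {Φ : Interaction E} {Ψ : ℕ → Interaction E}
    (hΦ : Φ.UniformlyAbsolutelyConvergent)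
    (hH : ∀ Λ : Finset ℤ, ∃ D : ℕ → ℝ, Tendsto D atTop (𝓝 0) ∧
      ∀ k σ, |(Ψ k).hamiltonian Λ σ - Φ.hamiltonian Λ σ| ≤ D k)
    (hΨ : ∀ k, (Ψ k).UniformlyAbsolutelyConvergent)
    {ν : ℕ → ProbabilityMeasure (ℤ → E)} (hν : ∀ k, (Ψ k).IsGibbs (ν k)) {l : Filter ℕ} [l.NeBot]
    (hl : l ≤ atTop) {μ : ProbabilityMeasure (ℤ → E)} (hμ : Tendsto ν l (𝓝 μ)) :
    Φ.IsGibbs μ := by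
  refine isGibbs_of_continuous hΦ fun Λ f hf => ?_
  obtain ⟨D, hD, hDk⟩ := hH Λ
  obtain ⟨C, hC⟩ := (isCompact_range hf).isBounded.exists_norm_le
  have hosc : ∀ σ τ, f σ - f τ ≤ 2 * C := fun σ τ => by
    have h₁ := (abs_le.1 (hC (f σ) ⟨σ, rfl⟩)).2
    have h₂ := (abs_le.1 (hC (f τ) ⟨τ, rfl⟩)).1
    linarith
  have hpt : ∀ k σ, ‖(Ψ k).specAvg Λ f σ - Φ.specAvg Λ f σ‖ ≤ D k / 2 * (2 * C) := fun k σ => by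
    rw [specAvg_eq_boltzmannAvg, specAvg_eq_boltzmannAvg]
    exact abs_boltzmannAvg_sub_le (fun ξ => hDk k _) fun ξ ξ' => hosc _ _
  have hcont := continuous_specAvg hΦ Λ hf
  have hint : ∀ k, ‖∫ σ, f σ ∂(ν k : Measure (ℤ → E)) -
      ∫ σ, Φ.specAvg Λ f σ ∂(ν k : Measure (ℤ → E))‖ ≤ D k / 2 * (2 * C) := fun k => by
    rw [← hν k Λ f (integrable_of_continuous _ hf), ← integral_sub
      (integrable_of_continuous _ (continuous_specAvg (hΨ k) Λ hf))
      (integrable_of_continuous _ hcont)]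
    simpa using norm_integral_le_of_norm_le_const (μ := (ν k : Measure (ℤ → E)))
      (Eventually.of_forall fun σ => hpt k σ)
  have hlim : Tendsto (fun k => D k / 2 * (2 * C)) l (𝓝 0) := by
    simpa using ((hD.mono_left hl).div_const 2).mul_const (2 * C)
  have h0 := tendsto_nhds_unique (squeeze_zero_norm hint hlim)
    ((tendsto_integral hμ hf).sub (tendsto_integral hμ hcont))
  linarith

end Interaction

/-- Uniform integrability of the densities makes absolute continuity pass to weak limits: a null
set has an open neighbourhood that is small for all the measures at once, and the mass of an open
set is lower semicontinuous. -/
lemma absolutelyContinuous_of_tendsto {X ι : Type*} [TopologicalSpace X]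
    [TopologicalSpace.PseudoMetrizableSpace X] [MeasurableSpace X] [BorelSpace X]
    {ρ : Measure X} [IsFiniteMeasure ρ] {ν : ι → ProbabilityMeasure X}
    (hν : ∀ k, (ν k : Measure X) ≪ ρ)
    (hUI : UnifIntegrable (fun k σ => ((ν k : Measure X).rnDeriv ρ σ).toReal) 1 ρ)
    {l : Filter ι} [l.NeBot] {μ : ProbabilityMeasure X} (hμ : Tendsto ν l (𝓝 μ)) :
    (μ : Measure X) ≪ ρ := by
  intro A hA
  refine le_antisymm (le_of_forall_pos_le_add fun ε hε => ?_) zero_le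
  rw [zero_add]
  rcases eq_or_ne ε ⊤ with rfl | hεtop
  · exact le_top
  obtain ⟨δ, hδ, hUδ⟩ := hUI (ENNReal.toReal_pos hε.ne' hεtop)
  obtain ⟨U, hAU, hU, hρU⟩ := A.exists_isOpen_lt_of_lt (μ := ρ) (ENNReal.ofReal δ)
    (by rw [hA]; exact ENNReal.ofReal_pos.2 hδ)
  have hνU : ∀ k, (ν k : Measure X) U ≤ ε := fun k => by
    have := hUδ k U hU.measurableSet hρU.le
    rw [eLpNorm_one_eq_lintegral_enorm, ENNReal.ofReal_toReal hεtop] at this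
    refine le_trans (le_of_eq ?_) this
    rw [← Measure.setLIntegral_rnDeriv (hν k), ← lintegral_indicator hU.measurableSet]
    refine lintegral_congr_ae ?_
    filter_upwards [(ν k : Measure X).rnDeriv_lt_top ρ] with σ hσ
    by_cases hσU : σ ∈ U
    · rw [Set.indicator_of_mem hσU, Set.indicator_of_mem hσU,
        Real.enorm_of_nonneg ENNReal.toReal_nonneg, ENNReal.ofReal_toReal hσ.ne]
    · rw [Set.indicator_of_notMem hσU, Set.indicator_of_notMem hσU, enorm_zero]
  calc (μ : Measure X) A ≤ (μ : Measure X) U := measure_mono hAU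
    _ ≤ l.liminf fun k => (ν k : Measure X) U :=
        ProbabilityMeasure.le_liminf_measure_open_of_tendsto hμ hU
    _ ≤ l.liminf fun _ => ε := liminf_le_liminf (Eventually.of_forall hνU)
    _ = ε := liminf_const ε

end Limits

end LatticeGibbs

/-! ### Gibbs measures of the intermediate interactions and their limits -/

theorem theoremD {E : Type*} [Fintype E] [Nonempty E] [TopologicalSpace E] [DiscreteTopology E]
    [MeasurableSpace E] [BorelSpace E]
    (Φ : LatticeGibbs.Interaction E)
    (hUAC : Φ.UniformlyAbsolutelyConvergent)
    (hDob : Φ.dobrushinConstant < 1)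
    (e : ℕ ≃ LatticeGibbs.crossingSets) :
    (∀ k : ℕ, ∃! μ : ProbabilityMeasure (ℤ → E), (Φ.intermediate e k).IsGibbs μ) ∧
    ∀ ν : ℕ → ProbabilityMeasure (ℤ → E), (∀ k, (Φ.intermediate e k).IsGibbs (ν k)) →
      (∀ k, (ν k : Measure (ℤ → E)) ≪ (ν 0 : Measure (ℤ → E))) ∧
      (UniformIntegrable
          (fun (k : ℕ) (σ : ℤ → E) =>
            ((ν k : Measure (ℤ → E)).rnDeriv (ν 0 : Measure (ℤ → E)) σ).toReal)
          1 (ν 0 : Measure (ℤ → E)) →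
        ∀ μ : ProbabilityMeasure (ℤ → E), MapClusterPt μ atTop ν →
          Φ.IsGibbs μ ∧ (μ : Measure (ℤ → E)) ≪ (ν 0 : Measure (ℤ → E))) := by
  have huac := hUAC.intermediate e
  have hdob : ∀ k, (Φ.intermediate e k).dobrushinConstant < 1 := fun k =>
    (Φ.dobrushinConstant_intermediate_le e k).trans_lt hDob
  refine ⟨fun k => ?_, fun ν hν => ?_⟩
  · obtain ⟨μ, hμ⟩ := LatticeGibbs.Interaction.exists_isGibbs (huac k)
    exact ⟨μ, hμ, fun μ' hμ' => hμ'.eq (huac k) (hdob k) hμ⟩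
  have hac : ∀ k, (ν k : Measure (ℤ → E)) ≪ (ν 0 : Measure (ℤ → E)) := fun k => by
    have htilt := (hν 0).tilted (huac k)
      (W := fun σ => ∑ j ∈ Finset.range k, Φ.pot (e j) σ)
      (continuous_finsetSum _ fun j _ => Φ.continuous_pot (e j))
      fun Λ σ τ => LatticeGibbs.Interaction.hamiltonian_intermediate_sub e hUAC k Λ
    rw [(hν k).eq (huac k) (hdob k) htilt]
    exact tilted_absolutelyContinuous _ _
  refine ⟨hac, fun hUI μ hμ => ?_⟩
  obtain ⟨U, hU, hlim⟩ := mapClusterPt_iff_ultrafilter.1 hμ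
  exact ⟨LatticeGibbs.Interaction.isGibbs_of_tendsto hUAC
      (LatticeGibbs.Interaction.exists_abs_hamiltonian_intermediate_sub_le e hUAC) huac hν hU hlim,
    LatticeGibbs.absolutelyContinuous_of_tendsto hac hUI.2.1 hlim⟩
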